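/- Let $\mathcal H,\mathcal K$ be finite-dimensional complex Hilbert spaces, and let $\mathcal A\subseteq B(\mathcal H)$, $\mathcal B\subseteq B(\mathcal K)$ be $C^*$-subalgebras containing the identity operators. Both carry the trace $\mathrm{Tr}$ of the underlying Hilbert space and the Hilbert–Schmidt inner product $\langle a,b\rangle=\mathrm{Tr}\,a^*b$; a state (density operator) of $\mathcal A$ is a positive element of trace $1$. For a linear map $T:\mathcal A\to\mathcal B$ let $T^*:\mathcal B\to\mathcal A$ be its adjoint for these inner products. A linear map $\Phi$ is a unital Schwarz map if $\Phi(I)=I$ and $\Phi(a^*a)\ge\Phi(a)^*\Phi(a)$ for all $a$. Let $\rho\in\mathcal A$ be an invertible density operator, let $x\in\mathcal A$ be self-adjoint with $\mathrm{Tr}\,x=0$, and let $T:\mathcal A\to\mathcal B$ be a linear map such that $T(\rho)$ is invertible and both $T^*$ and $$T_\rho(b)=T(\rho)^{-1/2}\,T(\rho^{1/2}b\rho^{1/2})\,T(\rho)^{-1/2}\qquad(b\in\mathcal A)$$ are unital Schwarz maps. Let $I_{\rho,x}$ be the largest interval of real $u$ containing $0$ for which $\rho+ux$ is a state, and let $\mathcal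 S_{\rho,x}=\{\rho+ux:\ u\in I_{\rho,x}\}$. We say that $T$ is reversible for a set $\mathcal S$ of states if there is a linear map $S:\mathcal B\to\mathcal A$ such that $S^*$ is a unital Schwarz map and $S(T(\sigma))=\sigma$ for all $\sigma\in\mathcal S$. For an operator monotone function $f:(0,\infty)\to(0,\infty)$ with $f(t)=t\,f(t^{-1})$ for all $t>0$, the monotone metric $\lambda^f$ is given by $$\lambda^f_\rho(x,y)=\mathrm{Tr}\,(J^f_\rho)^{-1}(x)\,y,\qquad J^f_\rho=f(\Delta_\rho)R_\rho,\qquad \Delta_\rho(a)=\rho a\rho^{-1},\qquad R_\rho(a)=a\rho\qquad(a\in\mathcal A),$$ and similarly at $T(\rho)$, with operators acting on $\mathcal B$. Let $\nu_f$ denote the positive Borel measure on $[0,\infty)$ with $\int(1+s^2)^{-1}d\nu_f(s)<\infty$ and $\int s(1+s^2)^{-1}d\nu_f(s)<\infty$ such that, for some constant $c\ge0$, $$f(t)^{-1}=c+\int_{[0,\infty)}\frac{1}{s+t}\,d\nu_f(s),\qquad t>0 .$$ Then the following are equivalent. 1. There is a monotone metric $\lambda^f$ with $|\mathrm{supp}\,\nu_f|\ge|\mathrm{spec}(\Delta_\rho)\cup\mathrm{spec}(\Delta_{T(\rho)})|$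 such that $\lambda^f_\rho(x,x)=\lambda^f_{T(\rho)}(T(x),T(x))$. 2. $\rho^{it}x\rho^{-it-1}=T^*\big(T(\rho)^{it}\,T(x)\,T(\rho)^{-it-1}\big)$ for all $t\in\mathbb R$. 3. $\rho^{-1/2}x\rho^{-1/2}=T^*\big(T(\rho)^{-1/2}\,T(x)\,T(\rho)^{-1/2}\big)$. 4. $T$ is reversible for $\mathcal S_{\rho,x}$. 5. $\lambda^f_\rho(x,x)=\lambda^f_{T(\rho)}(T(x),T(x))$ for every monotone metric $\lambda^f$. -/

import Mathlib

open MeasureTheory Set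

noncomputable section

namespace QRev

variable {H K : Type*}
  [NormedAddCommGroup H] [InnerProductSpace ℂ H] [CompleteSpace H] [FiniteDimensional ℂ H]
  [NormedAddCommGroup K] [InnerProductSpace ℂ K] [CompleteSpace K] [FiniteDimensional ℂ K]

/-! A finite-dimensional C*-algebra `𝒜 ⊆ B(H)` is a (unital) `StarSubalgebra ℂ (H →L[ℂ] H)`. -/

/-- In finite dimension every star subalgebra is norm closed; by Mathlib's
`StarSubalgebra.cstarAlgebra` it is then a C*-algebra, with continuous functional calculus. -/
instance isClosed_coe (A : StarSubalgebra ℂ (H →L[ℂ] H)) :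
    IsClosed (A : Set (H →L[ℂ] H)) :=
  Submodule.closed_of_finiteDimensional (Subalgebra.toSubmodule A.toSubalgebra)

instance finiteDimensional_coe (A : StarSubalgebra ℂ (H →L[ℂ] H)) :
    FiniteDimensional ℂ A :=
  FiniteDimensional.finiteDimensional_submodule (Subalgebra.toSubmodule A.toSubalgebra)

/-- The trace `Tr = Tr_H` on `𝒜 ⊆ B(H)`. -/
def Tr {A : StarSubalgebra ℂ (H →L[ℂ] H)} : A →ₗ[ℂ] ℂ where
  toFun a := LinearMap.trace ℂ H ((a : H →L[ℂ] H) : H →ₗ[ℂ] H)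
  map_add' a b := by simp
  map_smul' c a := by simp

/-- The density operators (states) of `𝒜`: positive elements of unit trace. -/
def IsDensity {A : StarSubalgebra ℂ (H →L[ℂ] H)} (σ : A) : Prop :=
  0 ≤ (σ : H →L[ℂ] H) ∧ Tr σ = 1

theorem trace_star_mul_self {A : StarSubalgebra ℂ (H →L[ℂ] H)} (a : A) :
    Tr (star a * a) =
      ((∑ i, ‖(a : H →L[ℂ] H) (stdOrthonormalBasis ℂ H i)‖ ^ 2 : ℝ) : ℂ) := by
  have h := LinearMap.trace_eq_sum_inner
    (((star a * a : A) : H →L[ℂ] H) : H →ₗ[ℂ] H) (stdOrthonormalBasis ℂ H)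
  refine h.trans ?_
  rw [Complex.ofReal_sum]
  refine Finset.sum_congr rfl fun i _ => ?_
  have : (((star a * a : A) : H →L[ℂ] H) : H →ₗ[ℂ] H) (stdOrthonormalBasis ℂ H i)
      = ContinuousLinearMap.adjoint (a : H →L[ℂ] H)
          ((a : H →L[ℂ] H) (stdOrthonormalBasis ℂ H i)) := rfl
  rw [this, ContinuousLinearMap.adjoint_inner_right, inner_self_eq_norm_sq_to_K]
  norm_cast

theorem Tr_star {A : StarSubalgebra ℂ (H →L[ℂ] H)} (a : A) :
    Tr (star a) = starRingEnd ℂ (Tr a) := by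
  have h1 := LinearMap.trace_eq_sum_inner
    (((star a : A) : H →L[ℂ] H) : H →ₗ[ℂ] H) (stdOrthonormalBasis ℂ H)
  have h2 := LinearMap.trace_eq_sum_inner
    ((a : H →L[ℂ] H) : H →ₗ[ℂ] H) (stdOrthonormalBasis ℂ H)
  refine h1.trans ?_
  rw [show (Tr a : ℂ) = _ from h2, map_sum]
  refine Finset.sum_congr rfl fun i _ => ?_
  have : (((star a : A) : H →L[ℂ] H) : H →ₗ[ℂ] H) (stdOrthonormalBasis ℂ H i)
      = ContinuousLinearMap.adjoint (a : H →L[ℂ] H) (stdOrthonormalBasis ℂ H i) := rfl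
  rw [this, ContinuousLinearMap.adjoint_inner_right, inner_conj_symm]
  rfl

/-- The Hilbert-Schmidt inner product `⟨a, b⟩ = Tr a* b` on `𝒜`. -/
abbrev hsCore (A : StarSubalgebra ℂ (H →L[ℂ] H)) : InnerProductSpace.Core ℂ A where
  inner a b := Tr (star a * b)
  conj_inner_symm a b := by rw [← Tr_star, star_mul, star_star]
  re_inner_nonneg a := by
    rw [trace_star_mul_self]
    rw [RCLike.re_eq_complex_re, Complex.ofReal_re]
    exact Finset.sum_nonneg fun i _ => sq_nonneg _
  add_left a b c := by rw [star_add, add_mul, map_add]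
  smul_left a b c := by rw [star_smul, smul_mul_assoc, map_smul, smul_eq_mul]; rfl
  definite a h := by
    rw [trace_star_mul_self, Complex.ofReal_eq_zero,
      Finset.sum_eq_zero_iff_of_nonneg fun i _ => by positivity] at h
    apply Subtype.ext
    apply ContinuousLinearMap.coe_injective
    refine (stdOrthonormalBasis ℂ H).toBasis.ext fun i => ?_
    simpa using h i (Finset.mem_univ i)

/-- The adjoint `T* : ℬ → 𝒜` of a linear map `T : 𝒜 → ℬ` with respect to the
Hilbert-Schmidt inner products. -/
def hsAdjoint {A : StarSubalgebra ℂ (H →L[ℂ] H)} {B : StarSubalgebra ℂ (K →L[ℂ] K)}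
    (T : A →ₗ[ℂ] B) : B →ₗ[ℂ] A :=
  @LinearMap.adjoint ℂ A B _
    (hsCore A).toNormedAddCommGroup (hsCore B).toNormedAddCommGroup
    (InnerProductSpace.ofCore (hsCore A).toCore) (InnerProductSpace.ofCore (hsCore B).toCore)
    (finiteDimensional_coe A) (finiteDimensional_coe B) T

/-- The defining property `⟨T*(b), a⟩ = ⟨b, T(a)⟩` of the Hilbert-Schmidt adjoint. -/
theorem Tr_hsAdjoint {A : StarSubalgebra ℂ (H →L[ℂ] H)} {B : StarSubalgebra ℂ (K →L[ℂ] K)}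
    (T : A →ₗ[ℂ] B) (a : A) (b : B) :
    Tr (star (hsAdjoint T b) * a) = Tr (star b * T a) :=
  @LinearMap.adjoint_inner_left ℂ A B _
    (hsCore A).toNormedAddCommGroup (hsCore B).toNormedAddCommGroup
    (InnerProductSpace.ofCore (hsCore A).toCore) (InnerProductSpace.ofCore (hsCore B).toCore)
    (finiteDimensional_coe A) (finiteDimensional_coe B) T a b

/-- Unital Schwarz maps: `Φ(I) = I` and `Φ(a* a) ≥ Φ(a)* Φ(a)`. -/
def IsUnitalSchwarz {A : StarSubalgebra ℂ (H →L[ℂ] H)} {B : StarSubalgebra ℂ (K →L[ℂ] K)}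
    (Φ : A →ₗ[ℂ] B) : Prop :=
  Φ 1 = 1 ∧
    ∀ a : A, ((star (Φ a) * Φ a : B) : K →L[ℂ] K) ≤ ((Φ (star a * a) : B) : K →L[ℂ] K)

/-- The complex power `ρ ^ z`, by the continuous functional calculus of the C*-algebra `𝒜`
(used for positive invertible `ρ`). -/
def cpower {A : StarSubalgebra ℂ (H →L[ℂ] H)} (ρ : A) (z : ℂ) : A :=
  cfc (fun w : ℂ => w ^ z) ρ

/-- `T_ρ(b) = T(ρ)^{-1/2} T(ρ^{1/2} b ρ^{1/2}) T(ρ)^{-1/2}`, for `ρ` and `T(ρ)` invertible. -/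
def dualMap {A : StarSubalgebra ℂ (H →L[ℂ] H)} {B : StarSubalgebra ℂ (K →L[ℂ] K)}
    (T : A →ₗ[ℂ] B) (ρ : A) : A →ₗ[ℂ] B :=
  LinearMap.mulLeftRight ℂ (cpower (T ρ) (-1 / 2), cpower (T ρ) (-1 / 2)) ∘ₗ T ∘ₗ
    LinearMap.mulLeftRight ℂ (cpower ρ (1 / 2), cpower ρ (1 / 2))

/-- `T` is reversible for the set `𝒮`: there is a map `S : ℬ → 𝒜` such that `S*` is a unital
Schwarz map and `S(T(σ)) = σ` for all `σ ∈ 𝒮`. -/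
def IsReversible {A : StarSubalgebra ℂ (H →L[ℂ] H)} {B : StarSubalgebra ℂ (K →L[ℂ] K)}
    (T : A →ₗ[ℂ] B) (𝒮 : Set A) : Prop :=
  ∃ S : B →ₗ[ℂ] A, IsUnitalSchwarz (hsAdjoint S) ∧ ∀ σ ∈ 𝒮, S (T σ) = σ

/-- The parameters `u ∈ ℝ` for which `ρ + u x` is a state. As the set of states is convex, this
set is an interval (`ordConnected_stateInterval`), hence it is the largest interval `I` such that
`ρ + u x` is a state for all `u ∈ I`. -/
def stateInterval {A : StarSubalgebra ℂ (H →L[ℂ] H)} (ρ x : A) : Set ℝ :=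
  {u : ℝ | IsDensity (ρ + (u : ℂ) • x)}

theorem ordConnected_stateInterval {A : StarSubalgebra ℂ (H →L[ℂ] H)} (ρ x : A) :
    (stateInterval ρ x).OrdConnected := by
  rw [← convex_iff_ordConnected]
  intro u hu v hv a b ha hb hab
  have hab' : (a : ℂ) + b = 1 := by exact_mod_cast hab
  have key : ρ + ((a • u + b • v : ℝ) : ℂ) • x
      = (a : ℂ) • (ρ + (u : ℂ) • x) + (b : ℂ) • (ρ + (v : ℂ) • x) := by
    have : ρ = ((a : ℂ) + b) • ρ := by rw [hab', one_smul]
    nth_rewrite 1 [this]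
    simp only [smul_eq_mul, Complex.ofReal_add, Complex.ofReal_mul]
    module
  change IsDensity _
  rw [key]
  refine ⟨?_, ?_⟩
  · have h1 : 0 ≤ a • ((ρ + (u : ℂ) • x : A) : H →L[ℂ] H) := smul_nonneg ha hu.1
    have h2 : 0 ≤ b • ((ρ + (v : ℂ) • x : A) : H →L[ℂ] H) := smul_nonneg hb hv.1
    exact add_nonneg h1 h2
  · rw [map_add, map_smul, map_smul, hu.2, hv.2]
    simpa using hab'

/-- The maximal line segment of states `𝒮_{ρ,x} = {ρ + u x : u ∈ I_{ρ,x}}`. -/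
def stateSegment {A : StarSubalgebra ℂ (H →L[ℂ] H)} (ρ x : A) : Set A :=
  (fun u : ℝ => ρ + (u : ℂ) • x) '' stateInterval ρ x

/-- The modular operator `Δ_ρ = L_ρ R_ρ⁻¹`, that is `a ↦ ρ a ρ⁻¹`, acting on `𝒜`
(for invertible `ρ`). -/
def modularOp {A : StarSubalgebra ℂ (H →L[ℂ] H)} (ρ : A) : Module.End ℂ A :=
  LinearMap.mulLeft ℂ ρ * LinearMap.mulRight ℂ (Ring.inverse ρ)

/-- `f(D)` for a diagonalizable operator `D` with real spectrum on a finite-dimensional space: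
`p(D)`, where `p` is the polynomial interpolating `f` on the spectrum of `D`. -/
def opFun {V : Type*} [AddCommGroup V] [Module ℂ V] [FiniteDimensional ℂ V]
    (f : ℝ → ℝ) (D : Module.End ℂ V) : Module.End ℂ V :=
  Polynomial.aeval D (Lagrange.interpolate (Module.End.finite_spectrum D).toFinset id
    (fun z : ℂ => ((f z.re : ℝ) : ℂ)))

/-- `f(D)` acts on an eigenvector of `D` with eigenvalue `t` as multiplication by `f(t)`. -/
theorem opFun_apply_of_eigenvector {V : Type*} [AddCommGroup V] [Module ℂ V]
    [FiniteDimensional ℂ V] (f : ℝ → ℝ) (D : Module.End ℂ V) (t : ℝ) (v : V)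
    (h : Module.End.HasEigenvector D (t : ℂ) v) :
    opFun f D v = ((f t : ℝ) : ℂ) • v := by
  have ht : (t : ℂ) ∈ (Module.End.finite_spectrum D).toFinset := by
    rw [Set.Finite.mem_toFinset]
    exact (Module.End.hasEigenvalue_of_hasEigenvector h).mem_spectrum
  have he := Lagrange.eval_interpolate_at_node (v := (id : ℂ → ℂ))
    (fun z : ℂ => ((f z.re : ℝ) : ℂ)) Function.injective_id.injOn ht
  rw [opFun, Module.End.aeval_apply_of_hasEigenvector h]
  simp only [id, Complex.ofReal_re] at he
  rw [← he]

/-- `J^f_ρ = f(Δ_ρ) R_ρ`. -/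
def JOp {A : StarSubalgebra ℂ (H →L[ℂ] H)} (f : ℝ → ℝ) (ρ : A) : Module.End ℂ A :=
  opFun f (modularOp ρ) * LinearMap.mulRight ℂ ρ

/-- `λ^f_ρ(x, y) = Tr (J^f_ρ)⁻¹(x) y`. -/
def monotoneMetric {A : StarSubalgebra ℂ (H →L[ℂ] H)} (f : ℝ → ℝ) (ρ x y : A) : ℂ :=
  Tr (Ring.inverse (JOp f ρ) x * y)

/-- `f : (0,∞) → (0,∞)` is operator monotone: `f(X) ≤ f(Y)` for all positive invertible matrices
`X ≤ Y` of any size. (Values of `f` outside `(0,∞)` play no role.) -/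
def IsOperatorMonotone (f : ℝ → ℝ) : Prop :=
  (∀ t : ℝ, 0 < t → 0 < f t) ∧
    ∀ (n : ℕ) (X Y : EuclideanSpace ℂ (Fin n) →L[ℂ] EuclideanSpace ℂ (Fin n)),
      0 ≤ X → IsUnit X → X ≤ Y → cfc f X ≤ cfc f Y

/-- The functions `f` defining monotone metrics `λ^f`: operator monotone `f : (0,∞) → (0,∞)`
with the symmetry `f(t) = t f(t⁻¹)`. -/
def IsMetricFunction (f : ℝ → ℝ) : Prop :=
  IsOperatorMonotone f ∧ ∀ t : ℝ, 0 < t → f t = t * f t⁻¹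

/-- `ν` is the measure `ν_f` of the integral representation of `1/f`: a positive Borel measure
on `[0,∞)` with `∫ (1+s²)⁻¹ dν < ∞`, `∫ s (1+s²)⁻¹ dν < ∞` and
`f(t)⁻¹ = c + ∫ (s+t)⁻¹ dν(s)` for all `t > 0`, with a constant `c ≥ 0`. -/
def IsRepresentingMeasure (f : ℝ → ℝ) (ν : Measure ℝ) : Prop :=
  ν (Iio 0) = 0 ∧
    Integrable (fun s : ℝ => (1 + s ^ 2)⁻¹) ν ∧
    Integrable (fun s : ℝ => s * (1 + s ^ 2)⁻¹) ν ∧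
    ∃ c : ℝ, 0 ≤ c ∧ ∀ t : ℝ, 0 < t → (f t)⁻¹ = c + ∫ s, (s + t)⁻¹ ∂ν

end QRev

end

/-!
With `Q_g(x) = ⟨x, g(Δ_ρ) R_ρ⁻¹ x⟩`, the integral representation of `1/f` writes the monotone
metric `λ^f_ρ(x, x)` as a positive superposition of the forms `Q_g` for the resolvent kernels
`g t = (s + t)⁻¹`, `s ≥ 0`, and the constant. Each of these forms is given by the inverse of
`s R_ρ + L_ρ` (or of `R_ρ`), and the Schwarz inequality for `T*` shows both that it decreases
under `T` and that equality for a given `s` forces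
`(s + Δ_ρ)⁻¹ R_ρ⁻¹ x = T*((s + Δ_{T(ρ)})⁻¹ R_{T(ρ)}⁻¹ T(x))`. Equality of the metrics gives this
identity on the support of `ν_f`; as the resolvent kernels at `|spec|` many points `s ≥ 0` span
all functions on the spectra (a Cauchy matrix is invertible), the identity extends from the
resolvents to every function of the modular operators. The characters `t ↦ t^{iu}` separate the
spectra as well, and the function `t ↦ t^{-1/2}` yields the Petz dual as an inverse of `T` on
`𝒮_{ρ,x}`.
-/

open scoped Ring

noncomputable section

namespace QRev

section SpectralCalculus

variable {V : Type*} [AddCommGroup V] [Module ℂ V] [FiniteDimensional ℂ V]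

/-- The functional calculus `h ↦ h(D)` of an operator `D` with real eigenvalues, for complex valued
`h`; like `opFun`, it is the evaluation at `D` of an interpolating polynomial. -/
def spectralCalculus (D : Module.End ℂ V) : (ℝ → ℂ) →ₗ[ℂ] Module.End ℂ V :=
  (Polynomial.aeval D).toLinearMap ∘ₗ
    Lagrange.interpolate (Module.End.finite_spectrum D).toFinset id ∘ₗ
      LinearMap.funLeft ℂ ℂ Complex.re

theorem opFun_eq_spectralCalculus (f : ℝ → ℝ) (D : Module.End ℂ V) :
    opFun f D = spectralCalculus D (fun t => (f t : ℂ)) :=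
  rfl

theorem spectralCalculus_apply_of_mem_eigenspace {D : Module.End ℂ V} (h : ℝ → ℂ) {t : ℝ} {v : V}
    (hv : v ∈ D.eigenspace (t : ℂ)) : spectralCalculus D h v = h t • v := by
  rcases eq_or_ne v 0 with rfl | hv0
  · simp only [map_zero, smul_zero]
  have ht : (t : ℂ) ∈ (Module.End.finite_spectrum D).toFinset :=
    (Set.Finite.mem_toFinset _).2
      (Module.End.hasEigenvalue_of_hasEigenvector ⟨hv, hv0⟩).mem_spectrum
  have hnode := Lagrange.eval_interpolate_at_node (v := (id : ℂ → ℂ)) (fun z => h z.re)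
    Function.injective_id.injOn ht
  rw [id, Complex.ofReal_re] at hnode
  rw [← hnode]
  exact Module.End.aeval_apply_of_hasEigenvector ⟨hv, hv0⟩

end SpectralCalculus

variable {H K : Type*}
  [NormedAddCommGroup H] [InnerProductSpace ℂ H] [CompleteSpace H] [FiniteDimensional ℂ H]
  [NormedAddCommGroup K] [InnerProductSpace ℂ K] [CompleteSpace K] [FiniteDimensional ℂ K]
  {A : StarSubalgebra ℂ (H →L[ℂ] H)} {B : StarSubalgebra ℂ (K →L[ℂ] K)}

section Order

instance starOrderedRing_coe : StarOrderedRing A := by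
  refine StarOrderedRing.of_nonneg_iff' (fun {a b} hab c => add_le_add_right (α := H →L[ℂ] H) hab c)
    fun a => ⟨fun ha => ?_, ?_⟩
  · have hsa : IsSelfAdjoint a := Subtype.ext (IsSelfAdjoint.of_nonneg (R := H →L[ℂ] H) ha).star_eq
    have hspec : ∀ r ∈ spectrum ℝ a, 0 ≤ r := by
      intro r hr
      rw [← spectrum.preimage_algebraMap (S := ℂ), mem_preimage, StarSubalgebra.spectrum_eq,
        ← mem_preimage, spectrum.preimage_algebraMap] at hr
      exact spectrum_nonneg_of_nonneg (A := H →L[ℂ] H) ha hr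
    refine ⟨cfc Real.sqrt a, ?_⟩
    have hsqrt : star (cfc Real.sqrt a) = cfc Real.sqrt a := (cfc_predicate Real.sqrt a).star_eq
    rw [hsqrt, ← cfc_mul Real.sqrt Real.sqrt a,
      cfc_congr fun r hr => Real.mul_self_sqrt (hspec r hr), cfc_id' ℝ a]
  · rintro ⟨s, rfl⟩
    exact star_mul_self_nonneg (s : H →L[ℂ] H)

theorem Tr_mul_comm (a b : A) : Tr (a * b) = Tr (b * a) :=
  LinearMap.trace_mul_comm ℂ ((a : H →L[ℂ] H) : H →ₗ[ℂ] H) ((b : H →L[ℂ] H) : H →ₗ[ℂ] H)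

theorem re_Tr_star_mul_self_nonneg (a : A) : 0 ≤ (Tr (star a * a)).re :=
  (hsCore A).re_inner_nonneg a

theorem eq_zero_of_re_Tr_star_mul_self {a : A} (h : (Tr (star a * a)).re ≤ 0) : a = 0 := by
  refine (hsCore A).definite a ?_
  have h0 := le_antisymm h (re_Tr_star_mul_self_nonneg a)
  rw [trace_star_mul_self, Complex.ofReal_re] at h0
  exact (trace_star_mul_self a).trans (by rw [h0, Complex.ofReal_zero])

theorem ext_Tr {a b : A} (h : ∀ c : A, Tr (star c * a) = Tr (star c * b)) : a = b := by
  refine sub_eq_zero.1 (eq_zero_of_re_Tr_star_mul_self (le_of_eq ?_))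
  rw [mul_sub, map_sub, h, sub_self, Complex.zero_re]

theorem re_Tr_nonneg {a : A} (ha : 0 ≤ a) : 0 ≤ (Tr a).re := by
  obtain ⟨s, rfl⟩ := CStarAlgebra.nonneg_iff_eq_star_mul_self.1 ha
  exact re_Tr_star_mul_self_nonneg s

theorem re_Tr_mul_nonneg {a b : A} (ha : 0 ≤ a) (hb : 0 ≤ b) : 0 ≤ (Tr (a * b)).re := by
  obtain ⟨s, rfl⟩ := CStarAlgebra.nonneg_iff_eq_star_mul_self.1 hb
  rw [← mul_assoc, Tr_mul_comm, ← mul_assoc]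
  exact re_Tr_nonneg (star_right_conjugate_nonneg ha s)

theorem eq_zero_of_re_Tr_mul_star_mul_self {ρ a : A} (hρ : IsStrictlyPositive ρ)
    (h : (Tr (ρ * (star a * a))).re ≤ 0) : a = 0 := by
  have hs : star (CFC.sqrt ρ) = CFC.sqrt ρ := (CFC.sqrt_nonneg ρ).star_eq
  have hz : a * CFC.sqrt ρ = 0 := by
    refine eq_zero_of_re_Tr_star_mul_self (le_of_eq_of_le ?_ h)
    rw [star_mul, hs, Tr_mul_comm, mul_assoc, Tr_mul_comm, ← mul_assoc, mul_assoc,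
      CFC.sqrt_mul_sqrt_self ρ hρ.nonneg, Tr_mul_comm]
  exact hρ.isUnit_cfcSqrt.mul_left_eq_zero.1 hz

theorem nonneg_of_re_Tr_mul_nonneg {a : A} (hsa : IsSelfAdjoint a)
    (h : ∀ b : A, 0 ≤ b → 0 ≤ (Tr (a * b)).re) : 0 ≤ a := by
  rw [← CFC.negPart_eq_zero_iff a hsa]
  refine eq_zero_of_re_Tr_star_mul_self ?_
  have hneg := h a⁻ (CFC.negPart_nonneg a)
  nth_rw 1 [← CFC.posPart_sub_negPart a hsa] at hneg
  rw [sub_mul, CFC.posPart_mul_negPart, zero_sub, map_neg, Complex.neg_re] at hneg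
  rw [(CFC.negPart_nonneg a).star_eq]
  linarith

end Order

section UnitalSchwarz

theorem IsUnitalSchwarz.map_nonneg {Φ : A →ₗ[ℂ] B} (hΦ : IsUnitalSchwarz Φ) {a : A} (ha : 0 ≤ a) :
    0 ≤ Φ a := by
  obtain ⟨s, rfl⟩ := CStarAlgebra.nonneg_iff_eq_star_mul_self.1 ha
  exact (star_mul_self_nonneg (Φ s)).trans (hΦ.2 s)

theorem IsUnitalSchwarz.map_star {Φ : A →ₗ[ℂ] B} (hΦ : IsUnitalSchwarz Φ) (a : A) :
    Φ (star a) = star (Φ a) :=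
  StarHomClass.map_star (PositiveLinearMap.mk₀ Φ fun _ => hΦ.map_nonneg) a

variable {T : A →ₗ[ℂ] B}

theorem eq_hsAdjoint_of_Tr {S : B →ₗ[ℂ] A} (h : ∀ a b, Tr (star (S b) * a) = Tr (star b * T a)) :
    S = hsAdjoint T := by
  refine LinearMap.ext fun b => star_injective (ext_Tr fun c => ?_)
  rw [Tr_mul_comm, h, ← Tr_hsAdjoint, Tr_mul_comm]

variable (hT : IsUnitalSchwarz (hsAdjoint T))
include hT

theorem Tr_hsAdjoint_mul (a : A) (b : B) : Tr (hsAdjoint T b * a) = Tr (b * T a) := by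
  rw [← star_star b, hT.map_star, Tr_hsAdjoint]

theorem map_star_of_hsAdjoint (a : A) : T (star a) = star (T a) := by
  refine ext_Tr fun b => ?_
  calc Tr (star b * T (star a))
      = Tr (star (a * hsAdjoint T b)) := by rw [← Tr_hsAdjoint_mul hT, hT.map_star, star_mul]
    _ = Tr (star (T a * b)) := by
        rw [Tr_star, Tr_star, Tr_mul_comm, Tr_hsAdjoint_mul hT, Tr_mul_comm]
    _ = Tr (star b * star (T a)) := by rw [star_mul]

theorem map_nonneg_of_hsAdjoint {a : A} (ha : 0 ≤ a) : 0 ≤ T a := by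
  refine nonneg_of_re_Tr_mul_nonneg ?_ fun b hb => ?_
  · rw [IsSelfAdjoint, ← map_star_of_hsAdjoint hT, ha.star_eq]
  · rw [Tr_mul_comm, ← Tr_hsAdjoint_mul hT]
    exact re_Tr_mul_nonneg (hT.map_nonneg hb) ha

end UnitalSchwarz

section Powers

theorem finite_spectrum (a : A) : (spectrum ℂ a).Finite := by
  rw [StarSubalgebra.spectrum_eq, ← AlgEquiv.spectrum_eq (Module.End.toContinuousLinearMap H).symm]
  exact Module.End.finite_spectrum _

theorem semiconjBy_aeval {R : Type*} [Ring R] [Algebra ℂ R] {a x y : R}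
    (h : SemiconjBy a x y) (p : Polynomial ℂ) :
    SemiconjBy a (Polynomial.aeval x p) (Polynomial.aeval y p) := by
  induction p using Polynomial.induction_on' with
  | add p q hp hq => simpa only [map_add] using hp.add_right hq
  | monomial n c =>
    simp only [Polynomial.aeval_monomial]
    exact SemiconjBy.mul_right (Algebra.commutes c a).symm (h.pow_right n)

theorem semiconjBy_cfc {a x y : A} [IsStarNormal x] [IsStarNormal y] (h : SemiconjBy a x y)
    (f : ℂ → ℂ) : SemiconjBy a (cfc f x) (cfc f y) := by
  let s := ((finite_spectrum x).union (finite_spectrum y)).toFinset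
  let p := Lagrange.interpolate s id f
  have hp : ∀ z ∈ spectrum ℂ x ∪ spectrum ℂ y, f z = p.eval z := fun z hz =>
    (Lagrange.eval_interpolate_at_node f Function.injective_id.injOn
      ((Set.Finite.mem_toFinset _).2 hz)).symm
  rw [cfc_congr fun z hz => hp z (Or.inl hz), cfc_congr fun z hz => hp z (Or.inr hz),
    cfc_polynomial p x, cfc_polynomial p y]
  exact semiconjBy_aeval h p

variable {ρ : A} (hρ : IsStrictlyPositive ρ)
include hρ

theorem exists_pos_of_mem_spectrum {z : ℂ} (hz : z ∈ spectrum ℂ ρ) :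
    ∃ r : ℝ, 0 < r ∧ (r : ℂ) = z := by
  have hre : (z.re : ℂ) = z := (hρ.nonneg.isSelfAdjoint.mem_spectrum_eq_re hz).symm
  refine ⟨z.re, hρ.spectrum_pos (𝕜 := ℝ) ?_, hre⟩
  rwa [← spectrum.preimage_algebraMap (S := ℂ), mem_preimage, Complex.coe_algebraMap, hre]

theorem cpower_mul_cpower (z w : ℂ) : cpower ρ z * cpower ρ w = cpower ρ (z + w) := by
  rw [cpower, cpower, cpower, ← cfc_mul _ _ _ ((finite_spectrum ρ).continuousOn _)
    ((finite_spectrum ρ).continuousOn _)]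
  refine cfc_congr fun v hv => ?_
  obtain ⟨r, hr, rfl⟩ := exists_pos_of_mem_spectrum hρ hv
  exact (Complex.cpow_add _ _ (Complex.ofReal_ne_zero.2 hr.ne')).symm

theorem cpower_zero : cpower ρ 0 = 1 := by
  simp only [cpower, Complex.cpow_zero]
  exact cfc_const_one ℂ ρ hρ.nonneg.isSelfAdjoint.isStarNormal

theorem cpower_one : cpower ρ 1 = ρ := by
  simp only [cpower, Complex.cpow_one]
  exact cfc_id' ℂ ρ hρ.nonneg.isSelfAdjoint.isStarNormal

theorem star_cpower_ofReal (t : ℝ) : star (cpower ρ t) = cpower ρ t := by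
  rw [cpower, ← cfc_star]
  refine cfc_congr fun v hv => ?_
  obtain ⟨r, hr, rfl⟩ := exists_pos_of_mem_spectrum hρ hv
  change star ((r : ℂ) ^ (t : ℂ)) = (r : ℂ) ^ (t : ℂ)
  rw [← Complex.ofReal_cpow hr.le, RCLike.star_def, Complex.conj_ofReal]

theorem cpower_neg_one : cpower ρ (-1) = ρ⁻¹ʳ := by
  rw [← one_mul ρ⁻¹ʳ, Ring.eq_mul_inverse_iff_mul_eq _ _ _ hρ.isUnit]
  nth_rw 2 [← cpower_one hρ]
  rw [cpower_mul_cpower hρ, neg_add_cancel, cpower_zero hρ]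

theorem cpower_mul_of_mul_eq_smul {a : A} {t : ℝ} (ht : 0 < t) (h : ρ * a = (t : ℂ) • (a * ρ))
    (z : ℂ) : cpower ρ z * a = (t : ℂ) ^ z • (a * cpower ρ z) := by
  have := hρ.nonneg.isSelfAdjoint.isStarNormal
  have htρ : IsStarNormal ((t : ℂ) • ρ) := inferInstance
  have hconj : SemiconjBy a ((t : ℂ) • ρ) ρ := by rw [SemiconjBy, h, mul_smul_comm]
  rw [cpower, ← (semiconjBy_cfc hconj _).eq, ← cfc_comp_const_mul (t : ℂ) _ ρ
    (((finite_spectrum ρ).image _).continuousOn _), ← mul_smul_comm, ← cfc_const_mul _ _ _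
    ((finite_spectrum ρ).continuousOn _)]
  congr 1
  refine cfc_congr fun v hv => ?_
  obtain ⟨r, hr, rfl⟩ := exists_pos_of_mem_spectrum hρ hv
  exact Complex.mul_cpow_ofReal_nonneg ht.le hr.le z

theorem star_cpower_half : star (cpower ρ (1 / 2)) = cpower ρ (1 / 2) := by
  simpa using star_cpower_ofReal hρ (1 / 2)

theorem star_cpower_neg_half : star (cpower ρ (-1 / 2)) = cpower ρ (-1 / 2) := by
  simpa using star_cpower_ofReal hρ (-1 / 2)

theorem cpower_half_mul_cpower_neg_half : cpower ρ (1 / 2) * cpower ρ (-1 / 2) = 1 := by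
  rw [cpower_mul_cpower hρ, neg_div, add_neg_cancel, cpower_zero hρ]

theorem cpower_neg_half_mul_cpower_half : cpower ρ (-1 / 2) * cpower ρ (1 / 2) = 1 := by
  rw [cpower_mul_cpower hρ, neg_div, neg_add_cancel, cpower_zero hρ]

theorem cpower_half_mul_cpower_half : cpower ρ (1 / 2) * cpower ρ (1 / 2) = ρ := by
  rw [cpower_mul_cpower hρ, add_halves, cpower_one hρ]

end Powers

section ModularOperator

theorem iSup_eigenspace_eq_top_of_symmetric {V : Type*} [AddCommGroup V] [Module ℂ V]
    [FiniteDimensional ℂ V] (c : InnerProductSpace.Core ℂ V) {D : Module.End ℂ V}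
    (hD : ∀ v w, c.inner (D v) w = c.inner v (D w)) : ⨆ z : ℂ, D.eigenspace z = ⊤ := by
  let _ : NormedAddCommGroup V := c.toNormedAddCommGroup
  let _ : InnerProductSpace ℂ V := InnerProductSpace.ofCore c.toCore
  have hsymm : D.IsSymmetric := hD
  exact Submodule.orthogonal_eq_bot_iff.1 hsymm.orthogonalComplement_iSup_eigenspaces_eq_bot

theorem Tr_star_modularOp_mul {ρ : A} (hρ : IsSelfAdjoint ρ) (a b : A) :
    Tr (star (modularOp ρ a) * b) = Tr (star a * modularOp ρ b) := by
  change Tr (star (ρ * (a * ρ⁻¹ʳ)) * b) = Tr (star a * (ρ * (b * ρ⁻¹ʳ)))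
  rw [star_mul, star_mul, ← Ring.inverse_star, hρ.star_eq, mul_assoc, mul_assoc, Tr_mul_comm]
  simp only [mul_assoc]

theorem iSup_eigenspace_modularOp {ρ : A} (hρ : IsSelfAdjoint ρ) :
    ⨆ z : ℂ, (modularOp ρ).eigenspace z = ⊤ :=
  iSup_eigenspace_eq_top_of_symmetric (hsCore A) (Tr_star_modularOp_mul hρ)

/-- The superoperator `h(Δ_ρ) R_ρ⁻¹`. The paper's `(J^f_ρ)⁻¹` is `modularFun ρ (1 / f)`, and
`ρ^z x ρ^(-z-1)` is `modularFun ρ (fun t => t ^ z) x`. -/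
def modularFun (ρ : A) (h : ℝ → ℂ) : A →ₗ[ℂ] A :=
  LinearMap.mulRight ℂ ρ⁻¹ʳ ∘ₗ spectralCalculus (modularOp ρ) h

variable {ρ : A} (hρ : IsStrictlyPositive ρ)
include hρ

theorem mem_eigenspace_modularOp {a : A} {z : ℂ} :
    a ∈ (modularOp ρ).eigenspace z ↔ ρ * a = z • (a * ρ) := by
  rw [Module.End.mem_eigenspace_iff]
  change ρ * (a * ρ⁻¹ʳ) = z • a ↔ _
  rw [← mul_assoc, eq_comm, Ring.eq_mul_inverse_iff_mul_eq _ _ _ hρ.isUnit, eq_comm, smul_mul_assoc]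

theorem ofReal_re_Tr_mul_star_mul_self (a : A) :
    ((Tr (ρ * (star a * a))).re : ℂ) = Tr (ρ * (star a * a)) := by
  rw [← Complex.conj_eq_iff_re, ← Tr_star, star_mul, star_mul, star_star, hρ.nonneg.star_eq,
    Tr_mul_comm]

theorem exists_pos_of_mul_eq_smul {a : A} (ha : a ≠ 0) {z : ℂ} (h : ρ * a = z • (a * ρ)) :
    ∃ t : ℝ, 0 < t ∧ (t : ℂ) = z := by
  set p := (Tr (ρ * (star a * a))).re with hp
  set q := (Tr (ρ * (star (star a) * star a))).re with hq
  have hp0 : 0 < p := not_le.1 fun h0 => ha (eq_zero_of_re_Tr_mul_star_mul_self hρ h0)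
  have hq0 : 0 < q := not_le.1 fun h0 =>
    ha (star_eq_zero.1 (eq_zero_of_re_Tr_mul_star_mul_self hρ h0))
  have hqp : (q : ℂ) = z * p := by
    rw [hq, hp, ofReal_re_Tr_mul_star_mul_self hρ, ofReal_re_Tr_mul_star_mul_self hρ, star_star,
      ← mul_assoc, h, smul_mul_assoc, map_smul, smul_eq_mul, mul_assoc, Tr_mul_comm, mul_assoc]
  refine ⟨q / p, div_pos hq0 hp0, ?_⟩
  rw [Complex.ofReal_div, hqp, mul_div_cancel_right₀ _ (Complex.ofReal_ne_zero.2 hp0.ne')]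

theorem modularOp_ext {M : Type*} [AddCommGroup M] [Module ℂ M] {f g : A →ₗ[ℂ] M}
    (h : ∀ t : ℝ, 0 < t → ∀ a : A, ρ * a = (t : ℂ) • (a * ρ) → f a = g a) : f = g := by
  refine LinearMap.eqLocus_eq_top.1 (eq_top_iff.2 ?_)
  rw [← iSup_eigenspace_modularOp hρ.nonneg.isSelfAdjoint]
  refine iSup_le fun z a ha => ?_
  rw [mem_eigenspace_modularOp hρ] at ha
  rcases eq_or_ne a 0 with rfl | ha0
  · exact zero_mem _
  obtain ⟨t, ht, rfl⟩ := exists_pos_of_mul_eq_smul hρ ha0 ha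
  exact h t ht a ha

theorem modularFun_apply_of_mul_eq_smul (h : ℝ → ℂ) {a : A} {t : ℝ}
    (ha : ρ * a = (t : ℂ) • (a * ρ)) : modularFun ρ h a = h t • (a * ρ⁻¹ʳ) := by
  rw [modularFun, LinearMap.comp_apply, LinearMap.mulRight_apply,
    spectralCalculus_apply_of_mem_eigenspace h ((mem_eigenspace_modularOp hρ).2 ha), smul_mul_assoc]

theorem inverse_JOp {f : ℝ → ℝ} (hf : ∀ t, 0 < t → 0 < f t) :
    (JOp f ρ)⁻¹ʳ = modularFun ρ (fun t => ((f t)⁻¹ : ℝ)) := by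
  have hone : JOp f ρ * modularFun ρ (fun t => ((f t)⁻¹ : ℝ)) = 1 := by
    refine modularOp_ext hρ fun t ht a ha => ?_
    rw [Module.End.mul_apply, modularFun_apply_of_mul_eq_smul hρ _ ha, map_smul, JOp,
      Module.End.mul_apply, LinearMap.mulRight_apply, Ring.inverse_mul_cancel_right _ _ hρ.isUnit,
      opFun_eq_spectralCalculus,
      spectralCalculus_apply_of_mem_eigenspace _ ((mem_eigenspace_modularOp hρ).2 ha), smul_smul,
      ← Complex.ofReal_mul, inv_mul_cancel₀ (hf t ht).ne', Complex.ofReal_one, one_smul,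
      Module.End.one_apply]
  rw [← mul_one (JOp f ρ)⁻¹ʳ, ← hone]
  exact Ring.inverse_mul_cancel_left _ _ (IsUnit.of_mul_eq_one _ hone)

theorem monotoneMetric_eq {f : ℝ → ℝ} (hf : ∀ t, 0 < t → 0 < f t) (x y : A) :
    monotoneMetric f ρ x y = Tr (modularFun ρ (fun t => ((f t)⁻¹ : ℝ)) x * y) := by
  rw [monotoneMetric, inverse_JOp hρ hf]

theorem cpower_mul_mul_cpower (z : ℂ) (x : A) :
    cpower ρ z * x * cpower ρ (-z - 1) = modularFun ρ (fun t => (t : ℂ) ^ z) x := by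
  have hmul : LinearMap.mulLeftRight ℂ (cpower ρ z, cpower ρ (-z - 1))
      = modularFun ρ (fun t => (t : ℂ) ^ z) := by
    refine modularOp_ext hρ fun t ht a ha => ?_
    rw [modularFun_apply_of_mul_eq_smul hρ _ ha, LinearMap.mulLeftRight_apply,
      cpower_mul_of_mul_eq_smul hρ ht ha, smul_mul_assoc, mul_assoc, cpower_mul_cpower hρ,
      show z + (-z - 1) = -1 by ring, cpower_neg_one hρ]
  rw [← hmul, LinearMap.mulLeftRight_apply]

theorem exists_pos_of_mem_spectrum_modularOp {z : ℂ} (hz : z ∈ spectrum ℂ (modularOp ρ)) :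
    ∃ t : ℝ, 0 < t ∧ (t : ℂ) = z := by
  obtain ⟨a, ha, ha0⟩ := (Module.End.hasEigenvalue_iff_mem_spectrum.2 hz).exists_hasEigenvector
  exact exists_pos_of_mul_eq_smul hρ ha0 ((mem_eigenspace_modularOp hρ).1 ha)

theorem modularFun_eq_sum {F : Finset ℝ} (hF : ∀ z ∈ spectrum ℂ (modularOp ρ), z.re ∈ F)
    (h : ℝ → ℂ) (x : A) :
    modularFun ρ h x = ∑ t ∈ F, h t • modularFun ρ (Pi.single t 1) x := by
  have hsum : modularFun ρ h = ∑ t ∈ F, h t • modularFun ρ (Pi.single t 1) := by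
    refine modularOp_ext hρ fun t _ a ha => ?_
    rcases eq_or_ne a 0 with rfl | ha0
    · rw [map_zero, map_zero]
    have htF : t ∈ F := by
      simpa only [Complex.ofReal_re] using hF t (Module.End.hasEigenvalue_of_hasEigenvector
        ⟨(mem_eigenspace_modularOp hρ).2 ha, ha0⟩).mem_spectrum
    simp only [LinearMap.sum_apply, LinearMap.smul_apply, modularFun_apply_of_mul_eq_smul hρ _ ha]
    rw [Finset.sum_eq_single_of_mem t htF fun s _ hs => by
      rw [Pi.single_eq_of_ne hs.symm, zero_smul, smul_zero], Pi.single_eq_same, one_smul]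
  rw [hsum, LinearMap.sum_apply]
  rfl

end ModularOperator

section SchwarzGap

/-- The quadratic form `x ↦ ⟨x, g(Δ_ρ) R_ρ⁻¹ x⟩`; on self-adjoint `x` and for `g = 1 / f` it is the
monotone metric `λ^f_ρ(x, x)`. -/
def modularQuad (ρ : A) (g : ℝ → ℝ) (x : A) : ℝ :=
  (Tr (star (modularFun ρ (fun t => (g t : ℂ)) x) * x)).re

/-- The operator `α R_ρ + β L_ρ`, whose inverse is `g(Δ_ρ) R_ρ⁻¹` for `g t = (α + β t)⁻¹`. -/
def mulComb (ρ : A) (α β : ℝ) : A →ₗ[ℂ] A :=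
  (α : ℂ) • LinearMap.mulRight ℂ ρ + (β : ℂ) • LinearMap.mulLeft ℂ ρ

theorem mulComb_apply (ρ : A) (α β : ℝ) (a : A) :
    mulComb ρ α β a = (α : ℂ) • (a * ρ) + (β : ℂ) • (ρ * a) :=
  rfl

theorem Tr_star_mulComb_mul {ρ : A} (hρ : IsSelfAdjoint ρ) (α β : ℝ) (a b : A) :
    Tr (star (mulComb ρ α β a) * b) = Tr (star a * mulComb ρ α β b) := by
  simp only [mulComb_apply, star_add, star_smul, star_mul, hρ.star_eq, add_mul, mul_add,
    smul_mul_assoc, mul_smul_comm, map_add, map_smul, RCLike.star_def, Complex.conj_ofReal]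
  rw [mul_assoc, Tr_mul_comm, mul_assoc, mul_assoc]

theorem re_Tr_star_sub_mul_mulComb_sub {ρ : A} (hρ : IsSelfAdjoint ρ) (α β : ℝ) (a y : A) :
    (Tr (star (a - y) * mulComb ρ α β (a - y))).re = (Tr (star a * mulComb ρ α β a)).re
      - 2 * (Tr (star y * mulComb ρ α β a)).re + (Tr (star y * mulComb ρ α β y)).re := by
  have hsymm : Tr (star a * mulComb ρ α β y) = starRingEnd ℂ (Tr (star y * mulComb ρ α β a)) := by
    rw [← Tr_star_mulComb_mul hρ, ← Tr_star, star_mul, star_star]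
  simp only [map_sub, star_sub, sub_mul, mul_sub, hsymm, Complex.sub_re, Complex.conj_re]
  ring

theorem re_Tr_star_mul_mulComb (ρ : A) (α β : ℝ) (a : A) :
    (Tr (star a * mulComb ρ α β a)).re
      = α * (Tr (ρ * (star a * a))).re + β * (Tr (ρ * (star (star a) * star a))).re := by
  rw [mulComb_apply, mul_add, map_add, mul_smul_comm, mul_smul_comm, map_smul, map_smul,
    smul_eq_mul, smul_eq_mul, Complex.add_re, Complex.re_ofReal_mul, Complex.re_ofReal_mul,
    ← mul_assoc, Tr_mul_comm _ ρ, Tr_mul_comm (star a), mul_assoc ρ, star_star]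

theorem re_Tr_star_mul_mulComb_nonneg {ρ : A} (hρ : 0 ≤ ρ) {α β : ℝ} (hα : 0 ≤ α) (hβ : 0 ≤ β)
    (a : A) : 0 ≤ (Tr (star a * mulComb ρ α β a)).re := by
  rw [re_Tr_star_mul_mulComb]
  exact add_nonneg (mul_nonneg hα (re_Tr_mul_nonneg hρ (star_mul_self_nonneg a)))
    (mul_nonneg hβ (re_Tr_mul_nonneg hρ (star_mul_self_nonneg (star a))))

theorem eq_zero_of_re_Tr_star_mul_mulComb {ρ : A} (hρ : IsStrictlyPositive ρ) {α β : ℝ}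
    (hα : 0 ≤ α) (hβ : 0 ≤ β) (hαβ : 0 < α + β) {a : A}
    (ha : (Tr (star a * mulComb ρ α β a)).re ≤ 0) : a = 0 := by
  rw [re_Tr_star_mul_mulComb] at ha
  have hl := mul_nonneg hα (re_Tr_mul_nonneg hρ.nonneg (star_mul_self_nonneg a))
  have hr := mul_nonneg hβ (re_Tr_mul_nonneg hρ.nonneg (star_mul_self_nonneg (star a)))
  rcases hα.eq_or_lt with rfl | hα0
  · exact star_eq_zero.1 (eq_zero_of_re_Tr_mul_star_mul_self hρ
      (nonpos_of_mul_nonpos_right (by linarith) ((zero_add β).subst hαβ)))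
  · exact eq_zero_of_re_Tr_mul_star_mul_self hρ (nonpos_of_mul_nonpos_right (by linarith) hα0)

theorem mulComb_modularFun {ρ : A} (hρ : IsStrictlyPositive ρ) {α β : ℝ} (hα : 0 ≤ α) (hβ : 0 ≤ β)
    (hαβ : 0 < α + β) (x : A) :
    mulComb ρ α β (modularFun ρ (fun t => ((α + β * t)⁻¹ : ℝ)) x) = x := by
  have hid : mulComb ρ α β ∘ₗ modularFun ρ (fun t => ((α + β * t)⁻¹ : ℝ)) = LinearMap.id := by
    refine modularOp_ext hρ fun t ht a ha => ?_
    have hpos : α + β * t ≠ 0 := by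
      rcases hβ.eq_or_lt with rfl | hβ0
      · rw [zero_mul]
        exact hαβ.ne'
      · positivity
    rw [LinearMap.comp_apply, modularFun_apply_of_mul_eq_smul hρ _ ha, map_smul, mulComb_apply,
      Ring.inverse_mul_cancel_right _ _ hρ.isUnit, ← mul_assoc, ha, smul_mul_assoc,
      Ring.mul_inverse_cancel_right _ _ hρ.isUnit, smul_smul, ← add_smul, smul_smul,
      ← Complex.ofReal_mul, ← Complex.ofReal_add, ← Complex.ofReal_mul, inv_mul_cancel₀ hpos,
      Complex.ofReal_one, one_smul, LinearMap.id_apply]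
  exact LinearMap.congr_fun hid x

variable {T : A →ₗ[ℂ] B} (hT : IsUnitalSchwarz (hsAdjoint T))
include hT

theorem re_Tr_mul_star_hsAdjoint_mul_hsAdjoint_le {ρ : A} (hρ : 0 ≤ ρ) (b : B) :
    (Tr (ρ * (star (hsAdjoint T b) * hsAdjoint T b))).re ≤ (Tr (T ρ * (star b * b))).re := by
  have hgap : (0 : A) ≤ hsAdjoint T (star b * b) - star (hsAdjoint T b) * hsAdjoint T b :=
    sub_nonneg.2 (hT.2 b)
  have hnonneg := re_Tr_mul_nonneg hρ hgap
  rw [mul_sub, map_sub, Complex.sub_re, Tr_mul_comm, Tr_hsAdjoint_mul hT, Tr_mul_comm] at hnonneg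
  exact sub_nonneg.1 hnonneg

theorem re_Tr_mulComb_hsAdjoint_le {ρ : A} (hρ : 0 ≤ ρ) {α β : ℝ} (hα : 0 ≤ α) (hβ : 0 ≤ β)
    (b : B) :
    (Tr (star (hsAdjoint T b) * mulComb ρ α β (hsAdjoint T b))).re
      ≤ (Tr (star b * mulComb (T ρ) α β b)).re := by
  have hl := re_Tr_mul_star_hsAdjoint_mul_hsAdjoint_le hT hρ b
  have hr := re_Tr_mul_star_hsAdjoint_mul_hsAdjoint_le hT hρ (star b)
  rw [hT.map_star] at hr
  rw [re_Tr_star_mul_mulComb, re_Tr_star_mul_mulComb]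
  exact add_le_add (mul_le_mul_of_nonneg_left hl hα) (mul_le_mul_of_nonneg_left hr hβ)

theorem re_Tr_mulComb_sub_hsAdjoint_le {ρ : A} (hρ : 0 ≤ ρ) {α β : ℝ} (hα : 0 ≤ α) (hβ : 0 ≤ β)
    {a : A} {b : B} (hab : T (mulComb ρ α β a) = mulComb (T ρ) α β b) :
    (Tr (star (a - hsAdjoint T b) * mulComb ρ α β (a - hsAdjoint T b))).re
      ≤ (Tr (star a * mulComb ρ α β a)).re - (Tr (star b * mulComb (T ρ) α β b)).re := by
  have hle := re_Tr_mulComb_hsAdjoint_le hT hρ hα hβ b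
  rw [re_Tr_star_sub_mul_mulComb_sub hρ.isSelfAdjoint, Tr_hsAdjoint, hab]
  linarith

variable {ρ : A} (hρ : IsStrictlyPositive ρ) (hTρ : IsStrictlyPositive (T ρ)) {α β : ℝ}
  (hα : 0 ≤ α) (hβ : 0 ≤ β) (hαβ : 0 < α + β) (x : A)
include hρ hTρ hα hβ hαβ

theorem re_Tr_mulComb_modularFun_sub_le :
    letI e := modularFun ρ (fun t => ((α + β * t)⁻¹ : ℝ)) x
      - hsAdjoint T (modularFun (T ρ) (fun t => ((α + β * t)⁻¹ : ℝ)) (T x))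
    (Tr (star e * mulComb ρ α β e)).re ≤ modularQuad ρ (fun t => (α + β * t)⁻¹) x
      - modularQuad (T ρ) (fun t => (α + β * t)⁻¹) (T x) := by
  refine (re_Tr_mulComb_sub_hsAdjoint_le hT hρ.nonneg hα hβ ?_).trans (le_of_eq ?_)
  · rw [mulComb_modularFun hρ hα hβ hαβ, mulComb_modularFun hTρ hα hβ hαβ]
  · rw [mulComb_modularFun hρ hα hβ hαβ, mulComb_modularFun hTρ hα hβ hαβ, modularQuad, modularQuad]

theorem modularQuad_map_le :
    modularQuad (T ρ) (fun t => (α + β * t)⁻¹) (T x) ≤ modularQuad ρ (fun t => (α + β * t)⁻¹) x :=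
  sub_nonneg.1 ((re_Tr_star_mul_mulComb_nonneg hρ.nonneg hα hβ _).trans
    (re_Tr_mulComb_modularFun_sub_le hT hρ hTρ hα hβ hαβ x))

theorem modularFun_eq_hsAdjoint_of_modularQuad_le
    (h : modularQuad ρ (fun t => (α + β * t)⁻¹) x
      ≤ modularQuad (T ρ) (fun t => (α + β * t)⁻¹) (T x)) :
    modularFun ρ (fun t => ((α + β * t)⁻¹ : ℝ)) x
      = hsAdjoint T (modularFun (T ρ) (fun t => ((α + β * t)⁻¹ : ℝ)) (T x)) :=
  sub_eq_zero.1 (eq_zero_of_re_Tr_star_mul_mulComb hρ hα hβ hαβ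
    ((re_Tr_mulComb_modularFun_sub_le hT hρ hTρ hα hβ hαβ x).trans (sub_nonpos.2 h)))

end SchwarzGap

section Separation

theorem eq_zero_of_sum_mul_inv_add_eq_zero {F S : Finset ℝ} (hF : ∀ t ∈ F, 0 < t)
    (hS : ∀ s ∈ S, 0 ≤ s) (hcard : F.card ≤ S.card) {c : ℝ → ℂ}
    (h : ∀ s ∈ S, ∑ t ∈ F, ((s + t)⁻¹ : ℝ) * c t = 0) : ∀ t ∈ F, c t = 0 := by
  set v : ℝ → ℂ := fun t => -(t : ℂ) with hv
  have hinj : Function.Injective v := neg_injective.comp Complex.ofReal_injective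
  have hweight : ∀ t ∈ F, Lagrange.nodalWeight F v t ≠ 0 := fun t ht =>
    Lagrange.nodalWeight_ne_zero hinj.injOn ht
  -- The barycentric formula turns the sums in `h` into the values on `S` of this polynomial.
  set P := Lagrange.interpolate F v fun t => (Lagrange.nodalWeight F v t)⁻¹ * c t with hPdef
  have hroot : ∀ s ∈ S, P.eval (s : ℂ) = 0 := fun s hs => by
    have hne : ∀ t ∈ F, (s : ℂ) ≠ v t := fun t ht heq => by
      have hst : s = -t := Complex.ofReal_injective (by rw [heq, hv, Complex.ofReal_neg])
      linarith [hF t ht, hS s hs]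
    rw [hPdef, Lagrange.eval_interpolate_not_at_node _ hne, ← mul_zero, ← h s hs]
    congr 1
    refine Finset.sum_congr rfl fun t ht => ?_
    rw [mul_right_comm, mul_inv_cancel_left₀ (hweight t ht), hv, sub_neg_eq_add, mul_comm,
      Complex.ofReal_inv, Complex.ofReal_add]
  have hP : P = 0 := Polynomial.eq_zero_of_degree_lt_of_eval_index_eq_zero _
    Complex.ofReal_injective.injOn
    ((Lagrange.degree_interpolate_lt _ hinj.injOn).trans_le (Nat.cast_le.2 hcard)) hroot
  intro t ht
  have hval := Lagrange.eval_interpolate_at_node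
    (fun t => (Lagrange.nodalWeight F v t)⁻¹ * c t) hinj.injOn ht
  rw [← hPdef, hP, Polynomial.eval_zero, eq_comm, mul_eq_zero] at hval
  exact hval.resolve_left (inv_ne_zero (hweight t ht))

/-- The character `u ↦ t ^ (i u)` of the additive group `ℝ`. -/
def imaginaryPower (t : ℝ) : Multiplicative ℝ →* ℂ where
  toFun u := Complex.exp (u.toAdd * (Real.log t * Complex.I))
  map_one' := by rw [toAdd_one, Complex.ofReal_zero, zero_mul, Complex.exp_zero]
  map_mul' u v := by rw [toAdd_mul, Complex.ofReal_add, add_mul, Complex.exp_add]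

theorem imaginaryPower_ofAdd {t : ℝ} (ht : 0 < t) (u : ℝ) :
    imaginaryPower t (Multiplicative.ofAdd u) = (t : ℂ) ^ (Complex.I * u) := by
  rw [Complex.cpow_def_of_ne_zero (Complex.ofReal_ne_zero.2 ht.ne'), ← Complex.ofReal_log ht.le]
  exact congrArg Complex.exp (by rw [toAdd_ofAdd]; ring)

theorem imaginaryPower_injOn : InjOn imaginaryPower (Ioi 0) := by
  intro s hs t ht hst
  have hderiv : ∀ r : ℝ, HasDerivAt (fun u : ℝ => imaginaryPower r (Multiplicative.ofAdd u))
      (Real.log r * Complex.I) 0 := fun r =>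
    ((Complex.ofRealCLM.hasDerivAt (x := 0)).mul_const (Real.log r * Complex.I)).cexp.congr_deriv
      (by simp)
  have hlog := (hderiv s).unique (hst ▸ hderiv t)
  exact Real.log_injOn_pos hs ht
    (Complex.ofReal_injective (mul_right_cancel₀ Complex.I_ne_zero hlog))

theorem eq_zero_of_sum_imaginaryPower_eq_zero {F : Finset ℝ} (hF : ∀ t ∈ F, 0 < t) {c : ℝ → ℂ}
    (h : ∀ u : ℝ, ∑ t ∈ F, (t : ℂ) ^ (Complex.I * u) * c t = 0) : ∀ t ∈ F, c t = 0 := by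
  have hind : LinearIndepOn ℂ (fun t => (imaginaryPower t : Multiplicative ℝ → ℂ)) (F : Set ℝ) :=
    (linearIndependent_monoidHom (Multiplicative ℝ) ℂ).comp (fun t : F => imaginaryPower t)
      fun s t hst => Subtype.ext (imaginaryPower_injOn (hF s s.2) (hF t t.2) hst)
  refine linearIndepOn_finset_iff.1 hind c (funext fun u => ?_)
  rw [Finset.sum_apply, Pi.zero_apply, ← h u.toAdd]
  refine Finset.sum_congr rfl fun t ht => ?_
  rw [Pi.smul_apply, smul_eq_mul, mul_comm, ← imaginaryPower_ofAdd (hF t ht), ofAdd_toAdd]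

/-- The union of the spectra of the modular operators `Δ_ρ` and `Δ_σ`, as a finite set of reals. -/
def modularSpectrum (ρ : A) (σ : B) : Finset ℝ :=
  ((Module.End.finite_spectrum (modularOp ρ)).union
    (Module.End.finite_spectrum (modularOp σ))).toFinset.image Complex.re

theorem re_mem_modularSpectrum {ρ : A} {σ : B} {z : ℂ}
    (hz : z ∈ spectrum ℂ (modularOp ρ) ∪ spectrum ℂ (modularOp σ)) : z.re ∈ modularSpectrum ρ σ :=
  Finset.mem_image_of_mem _ ((Set.Finite.mem_toFinset _).2 hz)

theorem card_modularSpectrum_le (ρ : A) (σ : B) :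
    ((modularSpectrum ρ σ).card : ℕ∞)
      ≤ (spectrum ℂ (modularOp ρ) ∪ spectrum ℂ (modularOp σ)).encard := by
  rw [← Set.encard_coe_eq_coe_finsetCard, modularSpectrum, Finset.coe_image,
    Set.Finite.coe_toFinset]
  exact Set.encard_image_le _ _

variable {ρ : A} {σ : B} (hρ : IsStrictlyPositive ρ) (hσ : IsStrictlyPositive σ)
include hρ hσ

theorem pos_of_mem_modularSpectrum {t : ℝ} (ht : t ∈ modularSpectrum ρ σ) : 0 < t := by
  obtain ⟨z, hz, rfl⟩ := Finset.mem_image.1 ht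
  obtain ⟨t, ht0, rfl⟩ := ((Set.Finite.mem_toFinset _).1 hz).elim
    (exists_pos_of_mem_spectrum_modularOp hρ) (exists_pos_of_mem_spectrum_modularOp hσ)
  exact ht0

variable {x : A} {y : B} {Φ : B →ₗ[ℂ] A}

theorem modularFun_eq_of_separating {ι : Type*} {κ : ι → ℝ → ℂ}
    (hκ : ∀ c : ℝ → ℂ, (∀ i, ∑ t ∈ modularSpectrum ρ σ, κ i t * c t = 0) →
      ∀ t ∈ modularSpectrum ρ σ, c t = 0)
    (h : ∀ i, modularFun ρ (κ i) x = Φ (modularFun σ (κ i) y)) (g : ℝ → ℂ) :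
    modularFun ρ g x = Φ (modularFun σ g y) := by
  set d : ℝ → A := fun t =>
    modularFun ρ (Pi.single t 1) x - Φ (modularFun σ (Pi.single t 1) y) with hd
  have hsum : ∀ g : ℝ → ℂ, modularFun ρ g x - Φ (modularFun σ g y)
      = ∑ t ∈ modularSpectrum ρ σ, g t • d t := fun g => by
    rw [modularFun_eq_sum hρ fun z hz => re_mem_modularSpectrum (σ := σ) (Or.inl hz),
      modularFun_eq_sum hσ fun z hz => re_mem_modularSpectrum (ρ := ρ) (Or.inr hz), map_sum,
      ← Finset.sum_sub_distrib]
    simp only [hd, map_smul, smul_sub]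
  have hzero : ∀ t ∈ modularSpectrum ρ σ, d t = 0 := fun t ht => by
    refine (Module.forall_dual_apply_eq_zero_iff ℂ (d t)).1 fun φ =>
      hκ (fun t => φ (d t)) (fun i => ?_) t ht
    rw [← map_zero φ, ← sub_eq_zero.2 (h i), hsum, map_sum]
    simp only [map_smul, smul_eq_mul]
  rw [← sub_eq_zero, hsum]
  exact Finset.sum_eq_zero fun t ht => by rw [hzero t ht, smul_zero]

theorem modularFun_eq_of_inv_add {S : Set ℝ} (hS : ∀ s ∈ S, 0 ≤ s)
    (hcard : (spectrum ℂ (modularOp ρ) ∪ spectrum ℂ (modularOp σ)).encard ≤ S.encard)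
    (h : ∀ s ∈ S, modularFun ρ (fun t => ((s + t)⁻¹ : ℝ)) x
      = Φ (modularFun σ (fun t => ((s + t)⁻¹ : ℝ)) y)) (g : ℝ → ℂ) :
    modularFun ρ g x = Φ (modularFun σ g y) := by
  obtain ⟨S', hS', hcard'⟩ :=
    Set.exists_subset_encard_eq ((card_modularSpectrum_le ρ σ).trans hcard)
  lift S' to Finset ℝ using Set.finite_of_encard_eq_coe hcard'
  rw [Set.encard_coe_eq_coe_finsetCard, Nat.cast_inj] at hcard'
  refine modularFun_eq_of_separating hρ hσ (κ := fun (s : S') t => ((s + t)⁻¹ : ℝ))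
    (fun c hc => ?_) (fun s => h s (hS' s.2)) g
  exact eq_zero_of_sum_mul_inv_add_eq_zero (fun t => pos_of_mem_modularSpectrum hρ hσ)
    (fun s hs => hS s (hS' hs)) hcard'.ge fun s hs => hc ⟨s, hs⟩

theorem modularFun_eq_of_imaginary_power
    (h : ∀ u : ℝ, modularFun ρ (fun t => (t : ℂ) ^ (Complex.I * u)) x
      = Φ (modularFun σ (fun t => (t : ℂ) ^ (Complex.I * u)) y)) (g : ℝ → ℂ) :
    modularFun ρ g x = Φ (modularFun σ g y) :=
  modularFun_eq_of_separating hρ hσ (fun _ hc =>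
    eq_zero_of_sum_imaginaryPower_eq_zero (fun _ => pos_of_mem_modularSpectrum hρ hσ) hc) h g

end Separation

section RepresentingMeasure

theorem ae_mem_Ici {ν : Measure ℝ} (hν : ν (Iio 0) = 0) : ∀ᵐ s ∂ν, s ∈ Ici 0 :=
  mem_ae_iff.2 (by rwa [ofPred_mem_eq, compl_Ici])

theorem integrable_inv_add {ν : Measure ℝ} (hν : ν (Iio 0) = 0)
    (h1 : Integrable (fun s : ℝ => (1 + s ^ 2)⁻¹) ν)
    (h2 : Integrable (fun s : ℝ => s * (1 + s ^ 2)⁻¹) ν) {t : ℝ} (ht : 0 < t) :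
    Integrable (fun s : ℝ => (s + t)⁻¹) ν := by
  refine ((h1.add h2).const_mul (1 + t⁻¹)).mono' (by fun_prop) ?_
  filter_upwards [ae_mem_Ici hν] with s (hs : 0 ≤ s)
  have hexpand : (1 + t⁻¹) * ((1 + s) * (s + t)) = (1 + s ^ 2) + (s * (1 + s) * t⁻¹ + t + 2 * s
      + s * t) := by
    field_simp
    ring
  rw [Real.norm_of_nonneg (by positivity), Pi.add_apply, ← one_add_mul s, ← mul_assoc,
    ← div_eq_mul_inv, le_div_iff₀ (by positivity), inv_mul_le_iff₀ (by positivity), mul_comm,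
    mul_assoc, hexpand]
  exact le_add_of_nonneg_right (by positivity)

theorem support_subset_setOf_eq {X : Type*} [TopologicalSpace X] [MeasurableSpace X]
    {ν : Measure X} {C : Set X} (hC : IsClosed C) (hν : ∀ᵐ s ∂ν, s ∈ C)
    {g h : X → ℝ} (hgC : ContinuousOn g C) (hhC : ContinuousOn h C) (hg : Integrable g ν)
    (hh : Integrable h ν) (hle : ∀ s ∈ C, g s ≤ h s) (hint : ∫ s, h s ∂ν ≤ ∫ s, g s ∂ν) :
    ν.support ⊆ {s ∈ C | h s = g s} := by
  have hle_ae : g ≤ᵐ[ν] h := hν.mono hle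
  have heq := (integral_eq_iff_of_ae_le hg hh hle_ae).1
    ((integral_mono_ae hg hh hle_ae).antisymm hint)
  refine Measure.support_subset_of_isClosed ?_ (hν.and heq.symm)
  exact (hhC.prodMk hgC).preimage_isClosed_of_isClosed hC isClosed_diagonal

variable {ρ : A} (hρ : IsStrictlyPositive ρ)
include hρ

theorem exists_modularQuad_eq_sum (x : A) : ∃ (F : Finset ℝ) (w : ℝ → ℝ),
    (∀ t ∈ F, 0 < t) ∧ ∀ g : ℝ → ℝ, modularQuad ρ g x = ∑ t ∈ F, g t * w t := by
  refine ⟨modularSpectrum ρ ρ, fun t => (Tr (star (modularFun ρ (Pi.single t 1) x) * x)).re,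
    fun t => pos_of_mem_modularSpectrum hρ hρ, fun g => ?_⟩
  rw [modularQuad, modularFun_eq_sum hρ fun z hz => re_mem_modularSpectrum (σ := ρ) (Or.inl hz)]
  simp only [star_sum, star_smul, Finset.sum_mul, smul_mul_assoc, map_sum, map_smul, smul_eq_mul,
    RCLike.star_def, Complex.conj_ofReal, Complex.re_sum, Complex.re_ofReal_mul]

theorem re_monotoneMetric {f : ℝ → ℝ} (hf : ∀ t, 0 < t → 0 < f t) {x : A} (hx : IsSelfAdjoint x) :
    (monotoneMetric f ρ x x).re = modularQuad ρ (fun t => (f t)⁻¹) x := by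
  rw [monotoneMetric_eq hρ hf, modularQuad, Tr_mul_comm (star _), ← Complex.conj_re, ← Tr_star,
    star_mul, hx.star_eq]

theorem continuousOn_modularQuad_inv_add (x : A) :
    ContinuousOn (fun s => modularQuad ρ (fun t => (s + t)⁻¹) x) (Ici 0) := by
  obtain ⟨F, w, hF, hw⟩ := exists_modularQuad_eq_sum hρ x
  simp only [hw]
  exact continuousOn_finsetSum _ fun t ht => ContinuousOn.mul_const (ContinuousOn.inv₀ (by fun_prop)
    fun s (hs : 0 ≤ s) => (add_pos_of_nonneg_of_pos hs (hF t ht)).ne') _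

variable {ν : Measure ℝ} (hν : ν (Iio 0) = 0) (h1 : Integrable (fun s : ℝ => (1 + s ^ 2)⁻¹) ν)
  (h2 : Integrable (fun s : ℝ => s * (1 + s ^ 2)⁻¹) ν)
include hν h1 h2

theorem integrable_modularQuad_inv_add (x : A) :
    Integrable (fun s => modularQuad ρ (fun t => (s + t)⁻¹) x) ν := by
  obtain ⟨F, w, hF, hw⟩ := exists_modularQuad_eq_sum hρ x
  simp only [hw]
  exact integrable_finsetSum _ fun t ht => (integrable_inv_add hν h1 h2 (hF t ht)).mul_const _

theorem modularQuad_eq_integral {f : ℝ → ℝ} {c : ℝ}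
    (hc : ∀ t : ℝ, 0 < t → (f t)⁻¹ = c + ∫ s, (s + t)⁻¹ ∂ν) (x : A) :
    modularQuad ρ (fun t => (f t)⁻¹) x
      = c * modularQuad ρ (fun _ => 1) x + ∫ s, modularQuad ρ (fun t => (s + t)⁻¹) x ∂ν := by
  obtain ⟨F, w, hF, hw⟩ := exists_modularQuad_eq_sum hρ x
  simp only [hw, one_mul]
  rw [integral_finsetSum _ fun t ht => (integrable_inv_add hν h1 h2 (hF t ht)).mul_const _,
    Finset.mul_sum, ← Finset.sum_add_distrib]
  exact Finset.sum_congr rfl fun t ht => by rw [hc t (hF t ht), integral_mul_const, add_mul]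

end RepresentingMeasure

section Equality

variable {T : A →ₗ[ℂ] B} (hT : IsUnitalSchwarz (hsAdjoint T)) {ρ : A} (hρ : IsStrictlyPositive ρ)
  (hTρ : IsStrictlyPositive (T ρ))
include hT hρ hTρ

theorem modularQuad_one_map_le (x : A) :
    modularQuad (T ρ) (fun _ => 1) (T x) ≤ modularQuad ρ (fun _ => 1) x := by
  simpa only [zero_mul, add_zero, inv_one] using
    modularQuad_map_le hT hρ hTρ zero_le_one le_rfl (by rw [add_zero]; exact one_pos) x

theorem modularQuad_inv_add_map_le {s : ℝ} (hs : 0 ≤ s) (x : A) :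
    modularQuad (T ρ) (fun t => (s + t)⁻¹) (T x) ≤ modularQuad ρ (fun t => (s + t)⁻¹) x := by
  simpa only [one_mul] using
    modularQuad_map_le hT hρ hTρ hs zero_le_one (add_pos_of_nonneg_of_pos hs one_pos) x

theorem modularFun_inv_add_eq {s : ℝ} (hs : 0 ≤ s) {x : A}
    (h : modularQuad ρ (fun t => (s + t)⁻¹) x ≤ modularQuad (T ρ) (fun t => (s + t)⁻¹) (T x)) :
    modularFun ρ (fun t => ((s + t)⁻¹ : ℝ)) x
      = hsAdjoint T (modularFun (T ρ) (fun t => ((s + t)⁻¹ : ℝ)) (T x)) := by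
  simpa only [one_mul] using modularFun_eq_hsAdjoint_of_modularQuad_le hT hρ hTρ hs zero_le_one
    (add_pos_of_nonneg_of_pos hs one_pos) x (by simpa only [one_mul] using h)

theorem integral_modularQuad_le_of_monotoneMetric_eq {f : ℝ → ℝ} (hf : ∀ t, 0 < t → 0 < f t)
    {ν : Measure ℝ} (hν : IsRepresentingMeasure f ν) {x : A} (hx : IsSelfAdjoint x)
    (heq : monotoneMetric f ρ x x = monotoneMetric f (T ρ) (T x) (T x)) :
    ∫ s, modularQuad ρ (fun t => (s + t)⁻¹) x ∂ν
      ≤ ∫ s, modularQuad (T ρ) (fun t => (s + t)⁻¹) (T x) ∂ν := by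
  obtain ⟨h0, h1, h2, c, hc0, hc⟩ := hν
  have hTx : IsSelfAdjoint (T x) := by rw [IsSelfAdjoint, ← map_star_of_hsAdjoint hT, hx.star_eq]
  have hquad := congrArg Complex.re heq
  rw [re_monotoneMetric hρ hf hx, re_monotoneMetric hTρ hf hTx,
    modularQuad_eq_integral hρ h0 h1 h2 hc, modularQuad_eq_integral hTρ h0 h1 h2 hc] at hquad
  linarith [mul_le_mul_of_nonneg_left (modularQuad_one_map_le hT hρ hTρ x) hc0]

theorem support_subset_setOf_modularFun_eq {f : ℝ → ℝ} (hf : ∀ t, 0 < t → 0 < f t)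
    {ν : Measure ℝ} (hν : IsRepresentingMeasure f ν) {x : A} (hx : IsSelfAdjoint x)
    (heq : monotoneMetric f ρ x x = monotoneMetric f (T ρ) (T x) (T x)) :
    ν.support ⊆ {s | 0 ≤ s ∧ modularFun ρ (fun t => ((s + t)⁻¹ : ℝ)) x
      = hsAdjoint T (modularFun (T ρ) (fun t => ((s + t)⁻¹ : ℝ)) (T x))} := by
  have hint := integral_modularQuad_le_of_monotoneMetric_eq hT hρ hTρ hf hν hx heq
  obtain ⟨h0, h1, h2, -⟩ := hν
  have hsub := support_subset_setOf_eq isClosed_Ici (ae_mem_Ici h0)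
    (continuousOn_modularQuad_inv_add hTρ (T x)) (continuousOn_modularQuad_inv_add hρ x)
    (integrable_modularQuad_inv_add hTρ h0 h1 h2 (T x))
    (integrable_modularQuad_inv_add hρ h0 h1 h2 x)
    (fun s hs => modularQuad_inv_add_map_le hT hρ hTρ hs x) hint
  exact fun s hs => ⟨(hsub hs).1, modularFun_inv_add_eq hT hρ hTρ (hsub hs).1 (hsub hs).2.le⟩

end Equality

section SquareRoot

theorem isMetricFunction_sqrt : IsMetricFunction Real.sqrt := by
  refine ⟨⟨fun t => Real.sqrt_pos.2, fun n X Y hX _ hXY => ?_⟩, fun t _ => ?_⟩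
  · have hsqrt := CFC.sqrt_le_sqrt X Y hXY
    rwa [CFC.sqrt_eq_real_sqrt X, CFC.sqrt_eq_real_sqrt Y (hX.trans hXY), cfcₙ_eq_cfc,
      cfcₙ_eq_cfc] at hsqrt
  · rw [Real.sqrt_inv, ← div_eq_mul_inv, Real.div_sqrt]

/-- The measure `s^{-1/2} ds / π` on `[0,∞)`, as the image of a multiple of Lebesgue measure under
squaring; it represents `t ↦ t^{-1/2}`. -/
def sqrtMeasure : Measure ℝ :=
  ENNReal.ofReal Real.pi⁻¹ • (volume : Measure ℝ).map (fun u => u ^ 2)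

theorem sqrtMeasure_apply {s : Set ℝ} (hs : MeasurableSet s) :
    sqrtMeasure s = ENNReal.ofReal Real.pi⁻¹ * volume ((fun u : ℝ => u ^ 2) ⁻¹' s) := by
  rw [sqrtMeasure, Measure.smul_apply, Measure.map_apply (by fun_prop) hs, smul_eq_mul]

theorem integrable_sqrtMeasure {g : ℝ → ℝ} (hg : Measurable g) {C : ℝ}
    (h : ∀ u : ℝ, ‖g (u ^ 2)‖ ≤ C * (1 + u ^ 2)⁻¹) : Integrable g sqrtMeasure := by
  have hsq : Measurable fun u : ℝ => u ^ 2 := by fun_prop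
  refine Integrable.smul_measure ?_ ENNReal.ofReal_ne_top
  refine (integrable_map_measure hg.aestronglyMeasurable hsq.aemeasurable).2 ?_
  exact (integrable_inv_one_add_sq.const_mul C).mono' (hg.comp hsq).aestronglyMeasurable
    (ae_of_all _ h)

theorem integral_inv_add_sqrtMeasure {t : ℝ} (ht : 0 < t) :
    ∫ s, (s + t)⁻¹ ∂sqrtMeasure = (√t)⁻¹ := by
  have hs : 0 < √t := Real.sqrt_pos.2 ht
  have hscale : ∀ u : ℝ, (u ^ 2 + t)⁻¹ = t⁻¹ * (1 + ((√t)⁻¹ * u) ^ 2)⁻¹ := fun u => by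
    rw [mul_pow, inv_pow, Real.sq_sqrt ht.le, ← mul_inv, mul_one_add, mul_inv_cancel_left₀ ht.ne',
      add_comm]
  rw [sqrtMeasure, integral_smul_measure, integral_map (by fun_prop) (by fun_prop)]
  simp only [hscale]
  rw [integral_const_mul, Measure.integral_comp_mul_left (fun u : ℝ => (1 + u ^ 2)⁻¹),
    integral_univ_inv_one_add_sq, ENNReal.toReal_ofReal (by positivity), inv_inv, abs_of_pos hs,
    smul_eq_mul, smul_eq_mul]
  have hpi := Real.pi_ne_zero
  field_simp
  exact Real.sq_sqrt ht.le

theorem isRepresentingMeasure_sqrt : IsRepresentingMeasure Real.sqrt sqrtMeasure := by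
  refine ⟨?_, ?_, ?_, 0, le_rfl, fun t ht => by rw [integral_inv_add_sqrtMeasure ht, zero_add]⟩
  · have hempty : (fun u : ℝ => u ^ 2) ⁻¹' Iio 0 = ∅ :=
      eq_empty_of_forall_notMem fun u hu => (sq_nonneg u).not_gt hu
    rw [sqrtMeasure_apply measurableSet_Iio, hempty, measure_empty, mul_zero]
  · refine integrable_sqrtMeasure (C := 2) (by fun_prop) fun u => ?_
    rw [Real.norm_of_nonneg (by positivity), ← div_eq_mul_inv, le_div_iff₀ (by positivity),
      inv_mul_le_iff₀ (by positivity)]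
    nlinarith [sq_nonneg (u ^ 2 - 1), sq_nonneg (u ^ 2)]
  · refine integrable_sqrtMeasure (C := 2) (by fun_prop) fun u => ?_
    rw [Real.norm_of_nonneg (by positivity), ← div_eq_mul_inv, ← div_eq_mul_inv,
      div_le_div_iff₀ (by positivity) (by positivity)]
    nlinarith [sq_nonneg (u ^ 2 - 1), sq_nonneg (u ^ 2), sq_nonneg u]

theorem Ici_subset_support_sqrtMeasure : Ici 0 ⊆ sqrtMeasure.support := by
  intro s (hs : 0 ≤ s)
  refine (nhds_basis_opens s).mem_measureSupport.2 fun V ⟨hsV, hV⟩ => ?_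
  rw [sqrtMeasure_apply hV.measurableSet]
  refine ENNReal.mul_pos (ENNReal.ofReal_pos.2 (inv_pos.2 Real.pi_pos)).ne'
    ((hV.preimage (by fun_prop)).measure_pos volume ⟨√s, ?_⟩).ne'
  rwa [mem_preimage, Real.sq_sqrt hs]

theorem encard_support_sqrtMeasure : sqrtMeasure.support.encard = ⊤ :=
  ((Ici_infinite 0).mono Ici_subset_support_sqrtMeasure).encard_eq

end SquareRoot

section Reversibility

theorem exists_pos_nonneg_add_smul {E : Type*} [CStarAlgebra E] [PartialOrder E]
    [StarOrderedRing E] {a x : E} (ha : IsStrictlyPositive a) (hx : IsSelfAdjoint x) :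
    ∃ u : ℝ, 0 < u ∧ 0 ≤ a + u • x := by
  rcases subsingleton_or_nontrivial E with _ | _
  · exact ⟨1, one_pos, (Subsingleton.elim _ _).le⟩
  obtain ⟨r, hr, hra⟩ := (CFC.exists_pos_algebraMap_le_iff ha.isSelfAdjoint).2
    fun _ => ha.spectrum_pos
  set u := r * (1 + ‖x‖)⁻¹ with hu
  have hu0 : 0 < u := by positivity
  have hux : ‖u • x‖ ≤ r := by
    rw [norm_smul, Real.norm_of_nonneg hu0.le, hu, mul_assoc]
    exact mul_le_of_le_one_right hr.le (by rw [inv_mul_le_one₀ (by positivity)]; linarith)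
  refine ⟨u, hu0, neg_le_iff_add_nonneg.1 ?_⟩
  calc -(u • x) ≤ algebraMap ℝ E ‖-(u • x)‖ :=
        ((IsSelfAdjoint.all u).smul hx).neg.le_algebraMap_norm_self
    _ ≤ algebraMap ℝ E r := algebraMap_mono E (by rwa [norm_neg])
    _ ≤ a := hra

/-- The Petz dual `b ↦ ρ^{1/2} T*(T(ρ)^{-1/2} b T(ρ)^{-1/2}) ρ^{1/2}` of `T` at `ρ`, the map that
recovers the states in `𝒮_{ρ,x}`. -/
def petzDual (T : A →ₗ[ℂ] B) (ρ : A) : B →ₗ[ℂ] A :=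
  LinearMap.mulLeftRight ℂ (cpower ρ (1 / 2), cpower ρ (1 / 2)) ∘ₗ hsAdjoint T ∘ₗ
    LinearMap.mulLeftRight ℂ (cpower (T ρ) (-1 / 2), cpower (T ρ) (-1 / 2))

theorem petzDual_apply (T : A →ₗ[ℂ] B) (ρ : A) (b : B) :
    petzDual T ρ b = cpower ρ (1 / 2) *
      hsAdjoint T (cpower (T ρ) (-1 / 2) * b * cpower (T ρ) (-1 / 2)) * cpower ρ (1 / 2) :=
  rfl

theorem dualMap_apply (T : A →ₗ[ℂ] B) (ρ : A) (a : A) :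
    dualMap T ρ a = cpower (T ρ) (-1 / 2) *
      T (cpower ρ (1 / 2) * a * cpower ρ (1 / 2)) * cpower (T ρ) (-1 / 2) :=
  rfl

theorem Tr_sandwich (q a b : A) : Tr (q * a * q * b) = Tr (a * (q * b * q)) := by
  rw [mul_assoc, mul_assoc, Tr_mul_comm]
  simp only [mul_assoc]

variable {ρ : A} (hρ : IsStrictlyPositive ρ)
include hρ

theorem exists_leftInverse_of_isReversible (hρt : Tr ρ = 1) {x : A} (hx : IsSelfAdjoint x)
    (hxt : Tr x = 0) {T : A →ₗ[ℂ] B} (hrev : IsReversible T (stateSegment ρ x)) :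
    ∃ S : B →ₗ[ℂ] A, IsUnitalSchwarz (hsAdjoint S) ∧ S (T ρ) = ρ ∧ S (T x) = x := by
  obtain ⟨S, hS, hST⟩ := hrev
  have hseg : ∀ u : ℝ, 0 ≤ ρ + (u : ℂ) • x → S (T (ρ + (u : ℂ) • x)) = ρ + (u : ℂ) • x :=
    fun u hu => hST _ ⟨u, ⟨hu, by rw [map_add, map_smul, hxt, smul_zero, add_zero, hρt]⟩, rfl⟩
  have hSρ : S (T ρ) = ρ := by
    simpa only [Complex.ofReal_zero, zero_smul, add_zero, hρ.nonneg, forall_const] using hseg 0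
  have hρH : IsStrictlyPositive (ρ : H →L[ℂ] H) :=
    (hρ.isUnit.map A.subtype).isStrictlyPositive hρ.nonneg
  obtain ⟨u, hu, hpos⟩ := exists_pos_nonneg_add_smul hρH (hx.map A.subtype)
  have hSu := hseg u hpos
  rw [map_add, map_add, hSρ, map_smul, map_smul] at hSu
  have hu0 : (u : ℂ) ≠ 0 := Complex.ofReal_ne_zero.2 hu.ne'
  exact ⟨S, hS, hSρ, smul_right_injective A hu0 (add_left_cancel hSu)⟩

variable {T : A →ₗ[ℂ] B} (hT : IsUnitalSchwarz (hsAdjoint T)) (hTρ : IsStrictlyPositive (T ρ))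
include hT hTρ

theorem hsAdjoint_petzDual : hsAdjoint (petzDual T ρ) = dualMap T ρ := by
  refine (eq_hsAdjoint_of_Tr fun b a => ?_).symm
  rw [petzDual_apply, dualMap_apply, star_mul, star_mul, star_cpower_neg_half hTρ,
    ← map_star_of_hsAdjoint hT, star_mul, star_mul, star_cpower_half hρ, ← mul_assoc, ← mul_assoc,
    Tr_sandwich, Tr_mul_comm (T _), ← Tr_hsAdjoint_mul hT, Tr_mul_comm (hsAdjoint T _), Tr_sandwich]

theorem petzDual_map_self : petzDual T ρ (T ρ) = ρ := by
  have hone : cpower (T ρ) (-1 / 2) * T ρ * cpower (T ρ) (-1 / 2) = 1 := by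
    nth_rw 2 [← cpower_half_mul_cpower_half hTρ]
    rw [← mul_assoc, cpower_neg_half_mul_cpower_half hTρ, one_mul,
      cpower_half_mul_cpower_neg_half hTρ]
  rw [petzDual_apply, hone, hT.1, mul_one, cpower_half_mul_cpower_half hρ]

theorem isReversible_of_half {x : A} (hTd : IsUnitalSchwarz (dualMap T ρ))
    (hx : cpower ρ (-1 / 2) * x * cpower ρ (-1 / 2)
      = hsAdjoint T (cpower (T ρ) (-1 / 2) * T x * cpower (T ρ) (-1 / 2))) :
    IsReversible T (stateSegment ρ x) := by
  have hTx : petzDual T ρ (T x) = x := by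
    rw [petzDual_apply, ← hx, mul_assoc (cpower ρ (-1 / 2)), ← mul_assoc,
      cpower_half_mul_cpower_neg_half hρ, one_mul, mul_assoc, cpower_neg_half_mul_cpower_half hρ,
      mul_one]
  refine ⟨petzDual T ρ, by rwa [hsAdjoint_petzDual hρ hT hTρ], ?_⟩
  rintro _ ⟨u, -, rfl⟩
  simp only [map_add, map_smul, petzDual_map_self hρ hT hTρ, hTx]

end Reversibility

section Equivalences

variable {T : A →ₗ[ℂ] B} (hT : IsUnitalSchwarz (hsAdjoint T)) {ρ x : A}
  (hρ : IsStrictlyPositive ρ) (hTρ : IsStrictlyPositive (T ρ))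
include hρ hTρ

theorem cpower_mul_mul_cpower_eq_iff (z : ℂ) :
    cpower ρ z * x * cpower ρ (-z - 1)
        = hsAdjoint T (cpower (T ρ) z * T x * cpower (T ρ) (-z - 1)) ↔
      modularFun ρ (fun t => (t : ℂ) ^ z) x
        = hsAdjoint T (modularFun (T ρ) (fun t => (t : ℂ) ^ z) (T x)) := by
  rw [cpower_mul_mul_cpower hρ, cpower_mul_mul_cpower hTρ]

theorem cpower_neg_half_mul_mul_eq_iff :
    cpower ρ (-1 / 2) * x * cpower ρ (-1 / 2)
        = hsAdjoint T (cpower (T ρ) (-1 / 2) * T x * cpower (T ρ) (-1 / 2)) ↔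
      modularFun ρ (fun t => (t : ℂ) ^ (-1 / 2 : ℂ)) x
        = hsAdjoint T (modularFun (T ρ) (fun t => (t : ℂ) ^ (-1 / 2 : ℂ)) (T x)) := by
  rw [← cpower_mul_mul_cpower_eq_iff hρ hTρ, show (-(-1 / 2) - 1 : ℂ) = -1 / 2 by norm_num]

include hT

theorem modularFun_eq_of_leftInverse {S : B →ₗ[ℂ] A} (hS : IsUnitalSchwarz (hsAdjoint S))
    (hSρ : S (T ρ) = ρ) (hSx : S (T x) = x) (g : ℝ → ℂ) :
    modularFun ρ g x = hsAdjoint T (modularFun (T ρ) g (T x)) := by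
  refine modularFun_eq_of_inv_add hρ hTρ (S := Ici 0) (fun s => id)
    ((Ici_infinite (0 : ℝ)).encard_eq ▸ le_top)
    (fun s hs => modularFun_inv_add_eq hT hρ hTρ hs ?_) g
  simpa only [hSρ, hSx] using modularQuad_inv_add_map_le hS hTρ (hSρ.symm ▸ hρ) hs (T x)

theorem monotoneMetric_eq_of_modularFun_eq {f : ℝ → ℝ} (hf : ∀ t, 0 < t → 0 < f t)
    (h : ∀ g : ℝ → ℂ, modularFun ρ g x = hsAdjoint T (modularFun (T ρ) g (T x))) :
    monotoneMetric f ρ x x = monotoneMetric f (T ρ) (T x) (T x) := by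
  rw [monotoneMetric_eq hρ hf, monotoneMetric_eq hTρ hf, h, Tr_hsAdjoint_mul hT]

end Equivalences

end QRev

end

open QRev in
theorem proposition7_general {H K : Type*}
    [NormedAddCommGroup H] [InnerProductSpace ℂ H] [CompleteSpace H] [FiniteDimensional ℂ H]
    [NormedAddCommGroup K] [InnerProductSpace ℂ K] [CompleteSpace K] [FiniteDimensional ℂ K]
    {A : StarSubalgebra ℂ (H →L[ℂ] H)} {B : StarSubalgebra ℂ (K →L[ℂ] K)}
    {T : A →ₗ[ℂ] B} {ρ x : A}
    (hρ : IsDensity ρ) (hρ_inv : IsUnit ρ) (hTρ_inv : IsUnit (T ρ))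
    (hT : IsUnitalSchwarz (hsAdjoint T))
    (hTdual : IsUnitalSchwarz (dualMap T ρ))
    (hx : IsSelfAdjoint x) (hx_tr : Tr x = 0) {𝓕 : Set (ℝ → ℝ)}
    (h𝓕 : ∀ f ∈ 𝓕, ∀ t, 0 < t → 0 < f t) (hsqrt : Real.sqrt ∈ 𝓕) :
    List.TFAE [
      ∃ (f : ℝ → ℝ) (ν : MeasureTheory.Measure ℝ),
        f ∈ 𝓕 ∧ IsRepresentingMeasure f ν ∧
        (spectrum ℂ (modularOp ρ) ∪ spectrum ℂ (modularOp (T ρ))).encard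
          ≤ ν.support.encard ∧
        monotoneMetric f ρ x x = monotoneMetric f (T ρ) (T x) (T x),
      ∀ t : ℝ,
        cpower ρ (Complex.I * t) * x * cpower ρ (-(Complex.I * t) - 1)
          = hsAdjoint T
              (cpower (T ρ) (Complex.I * t) * T x *
                cpower (T ρ) (-(Complex.I * t) - 1)),
      cpower ρ (-1 / 2) * x * cpower ρ (-1 / 2)
        = hsAdjoint T
            (cpower (T ρ) (-1 / 2) * T x * cpower (T ρ) (-1 / 2)),
      IsReversible T (stateSegment ρ x),
      ∀ f ∈ 𝓕,
        monotoneMetric f ρ x x = monotoneMetric f (T ρ) (T x) (T x)] := by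
  have hρ_pos : IsStrictlyPositive ρ := hρ_inv.isStrictlyPositive hρ.1
  have hTρ_pos : IsStrictlyPositive (T ρ) :=
    hTρ_inv.isStrictlyPositive (map_nonneg_of_hsAdjoint hT hρ_pos.nonneg)
  tfae_have 1 → 2 := by
    rintro ⟨f, ν, hf, hν, hcard, heq⟩ t
    have hsupp := support_subset_setOf_modularFun_eq hT hρ_pos hTρ_pos (h𝓕 f hf) hν hx heq
    exact (cpower_mul_mul_cpower_eq_iff hρ_pos hTρ_pos _).2 (modularFun_eq_of_inv_add
      hρ_pos hTρ_pos (fun s hs => (hsupp hs).1) hcard (fun s hs => (hsupp hs).2) _)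
  tfae_have 2 → 3 := fun h2 =>
    (cpower_neg_half_mul_mul_eq_iff hρ_pos hTρ_pos).2 (modularFun_eq_of_imaginary_power
      hρ_pos hTρ_pos (fun t => (cpower_mul_mul_cpower_eq_iff hρ_pos hTρ_pos _).1 (h2 t)) _)
  tfae_have 3 → 4 := isReversible_of_half hρ_pos hT hTρ_pos hTdual
  tfae_have 4 → 5 := by
    intro hrev f hf
    obtain ⟨S, hS, hSρ, hSx⟩ :=
      exists_leftInverse_of_isReversible hρ_pos hρ.2 hx hx_tr hrev
    exact monotoneMetric_eq_of_modularFun_eq hT hρ_pos hTρ_pos (h𝓕 f hf)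
      (modularFun_eq_of_leftInverse hT hρ_pos hTρ_pos hS hSρ hSx)
  tfae_have 5 → 1 := fun h5 =>
    ⟨Real.sqrt, sqrtMeasure, hsqrt, isRepresentingMeasure_sqrt,
      encard_support_sqrtMeasure ▸ le_top, h5 _ hsqrt⟩
  tfae_finish

theorem proposition7 {H K : Type*}
    [NormedAddCommGroup H] [InnerProductSpace ℂ H] [CompleteSpace H] [FiniteDimensional ℂ H]
    [NormedAddCommGroup K] [InnerProductSpace ℂ K] [CompleteSpace K] [FiniteDimensional ℂ K]
    (A : StarSubalgebra ℂ (H →L[ℂ] H)) (B : StarSubalgebra ℂ (K →L[ℂ] K))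
    (T : A →ₗ[ℂ] B) (ρ x : A)
    (hρ : QRev.IsDensity ρ) (hρ_inv : IsUnit ρ) (hTρ_inv : IsUnit (T ρ))
    (hT : QRev.IsUnitalSchwarz (QRev.hsAdjoint T))
    (hTdual : QRev.IsUnitalSchwarz (QRev.dualMap T ρ))
    (hx : IsSelfAdjoint x) (hx_tr : QRev.Tr x = 0) :
    List.TFAE [
      -- preservation of one monotone metric with enough support points
      ∃ (f : ℝ → ℝ) (ν : MeasureTheory.Measure ℝ),
        QRev.IsMetricFunction f ∧ QRev.IsRepresentingMeasure f ν ∧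
        (spectrum ℂ (QRev.modularOp ρ) ∪ spectrum ℂ (QRev.modularOp (T ρ))).encard
          ≤ ν.support.encard ∧
        QRev.monotoneMetric f ρ x x = QRev.monotoneMetric f (T ρ) (T x) (T x),
      -- the identity with unitary powers
      ∀ t : ℝ,
        QRev.cpower ρ (Complex.I * t) * x * QRev.cpower ρ (-(Complex.I * t) - 1)
          = QRev.hsAdjoint T
              (QRev.cpower (T ρ) (Complex.I * t) * T x *
                QRev.cpower (T ρ) (-(Complex.I * t) - 1)),
      -- the identity with square roots
      QRev.cpower ρ (-1 / 2) * x * QRev.cpower ρ (-1 / 2)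
        = QRev.hsAdjoint T
            (QRev.cpower (T ρ) (-1 / 2) * T x * QRev.cpower (T ρ) (-1 / 2)),
      -- reversibility for the segment of states
      QRev.IsReversible T (QRev.stateSegment ρ x),
      -- preservation of all monotone metrics
      ∀ f : ℝ → ℝ, QRev.IsMetricFunction f →
        QRev.monotoneMetric f ρ x x = QRev.monotoneMetric f (T ρ) (T x) (T x)] := by
  exact proposition7_general hρ hρ_inv hTρ_inv hT hTdual hx hx_tr
    (𝓕 := {f | QRev.IsMetricFunction f}) (fun f hf => hf.1.1) QRev.isMetricFunction_sqrt
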